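/- Let $d\ge 0$ and let $|||\cdot|||$ be a unitarily invariant norm on the complex $d\times d$ matrices, i.e. a norm with $|||UXV|||=|||X|||$ for all matrices $X$ and all unitary $U,V$. For a positive semidefinite matrix $A$ with spectral decomposition $A=U\,\mathrm{diag}(\lambda_1,\dots,\lambda_d)\,U^*$ and a function $h:[0,\infty)\to\mathbb{R}$, let $h(A)=U\,\mathrm{diag}(h(\lambda_1),\dots,h(\lambda_d))\,U^*$. (i) For every $K\ge 0$, all positive semidefinite complex $d\times d$ matrices $A_1,\dots,A_K$ and all (not necessarily continuous) functions $f,g:[0,\infty)\to[0,\infty)$, $$\Big|\Big|\Big|\sum_{k=1}^K f(A_k)g(A_k)\Big|\Big|\Big|\le\Big|\Big|\Big|\Big(\sum_{k=1}^K f(A_k)\Big)\Big(\sum_{k=1}^K g(A_k)\Big)\Big|\Big|\Big|.$$ (ii) In particular, for all positive semidefinite complex $d\times d$ matrices $A,B$ and all real $p,q>0$, $$|||A^{p+q}+B^{p+q}|||\le|||(A^p+B^p)(A^q+B^q)|||,$$ as was conjectured by Bourin. -/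

import Mathlib

open scoped ComplexOrder MatrixOrder

/-- A seminorm on the complex `d × d` matrices is a unitarily invariant norm if it is a norm
(it vanishes only at `0`) and `N (U * X * V) = N X` for every matrix `X` and all unitary
`U`, `V`. -/
structure IsUnitarilyInvariantNorm {d : ℕ} (N : Seminorm ℂ (Matrix (Fin d) (Fin d) ℂ)) :
    Prop where
  eq_zero_of_map_eq_zero : ∀ X : Matrix (Fin d) (Fin d) ℂ, N X = 0 → X = 0
  unitary_mul_mul : ∀ U ∈ Matrix.unitaryGroup (Fin d) ℂ, ∀ V ∈ Matrix.unitaryGroup (Fin d) ℂ,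
    ∀ X : Matrix (Fin d) (Fin d) ℂ, N (U * X * V) = N X

open Matrix

/-! Write f(A_k) + δ = a_k² and g(A_k) + δ = b_k² with δ > 0 and a_k, b_k commuting Hermitian
matrices. The sum of the a_k² b_k² is the average over signs ε of T_ε², where T_ε = Σ ε_k a_k b_k,
so it suffices to bound each N(T_ε²).

With S² = Σ a_k² and R² = Σ b_k², T_ε = S W R for a contraction W, so T_ε² is similar to W
(RSW)(RS). A Hermitian matrix has least norm among its similar matrices (`le_of_similar`), the outer
W drops out, and the arithmetic-geometric mean inequality (`mul_le_half_add`) leaves R S² R and S R²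
S. Both are Hermitian and similar to S² R². Letting δ → 0 gives (i); (ii) is the case of two
matrices and power functions. -/

/-- Distinct random signs are uncorrelated. -/
theorem sum_sign_mul_sign {ι : Type*} [Fintype ι] [DecidableEq ι] (i j : ι) :
    ∑ ε : ι → ℤˣ, (((ε i : ℤ) : ℂ) * ((ε j : ℤ) : ℂ)) =
      if i = j then (Fintype.card (ι → ℤˣ) : ℂ) else 0 := by
  split_ifs with h
  · subst h
    have : ∀ ε : ι → ℤˣ, (((ε i : ℤ) : ℂ) * ((ε i : ℤ) : ℂ)) = 1 := fun ε => by
      rw [← Int.cast_mul, ← Units.val_mul, Int.units_mul_self]; simp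
    simp [this]
  -- Flipping the i-th sign permutes the sign vectors and negates the summand.
  · have key := Equiv.sum_comp (Equiv.mulLeft (Pi.mulSingle i (-1) : ι → ℤˣ))
      (fun ε : ι → ℤˣ => (((ε i : ℤ) : ℂ) * ((ε j : ℤ) : ℂ)))
    have hji : (Pi.mulSingle i (-1) : ι → ℤˣ) j = 1 := Pi.mulSingle_eq_of_ne (Ne.symm h) _
    simp only [Equiv.coe_mulLeft, Pi.mul_apply, Pi.mulSingle_eq_same, hji, one_mul, neg_mul,
      Units.val_neg, Int.cast_neg, Finset.sum_neg_distrib] at key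
    exact self_eq_neg.mp key.symm

/-! ### Unitary factorisations -/

namespace Matrix

variable {n : Type*} [Fintype n] [DecidableEq n]

/-- The matrix whose columns are the vectors of an orthonormal basis is unitary. -/
theorem of_orthonormalBasis_mem_unitaryGroup (b : OrthonormalBasis n ℂ (EuclideanSpace ℂ n)) :
    (of fun i j => b j i) ∈ unitaryGroup n ℂ := by
  rw [mem_unitaryGroup_iff']
  ext i j
  have := orthonormal_iff_ite.mp b.orthonormal i j
  rw [one_apply, ← this, EuclideanSpace.inner_eq_star_dotProduct]
  simp [mul_apply, star_eq_conjTranspose, dotProduct, mul_comm]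

/-- The spectral theorem in terms of an unbundled unitary matrix. -/
theorem IsHermitian.exists_eq_unitary_mul_diagonal_mul {M : Matrix n n ℂ} (hM : M.IsHermitian) :
    ∃ U ∈ unitaryGroup n ℂ, ∃ e : n → ℝ, M = U * diagonal (fun i => (e i : ℂ)) * Uᴴ := by
  have h := hM.spectral_theorem
  rw [Unitary.conjStarAlgAut_apply] at h
  exact ⟨_, hM.eigenvectorUnitary.2, _, h⟩

theorem conjTranspose_mem_unitaryGroup {U : Matrix n n ℂ} (hU : U ∈ unitaryGroup n ℂ) :
    Uᴴ ∈ unitaryGroup n ℂ :=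
  Unitary.star_mem hU

/-- **QR decomposition**: every square matrix is a unitary times an upper triangular one. -/
theorem exists_unitary_conjTranspose_mul_upperTriangular {m : ℕ}
    (X : Matrix (Fin m) (Fin m) ℂ) :
    ∃ Q ∈ unitaryGroup (Fin m) ℂ, ∀ i j, j < i → (Qᴴ * X) i j = 0 := by
  let f : Fin m → EuclideanSpace ℂ (Fin m) := fun j => WithLp.toLp 2 fun i => X i j
  let b := InnerProductSpace.gramSchmidtOrthonormalBasis (𝕜 := ℂ) (by simp) f
  refine ⟨_, of_orthonormalBasis_mem_unitaryGroup b, fun i j hij => ?_⟩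
  have := InnerProductSpace.gramSchmidtOrthonormalBasis_inv_triangular (𝕜 := ℂ) (by simp) f hij
  rw [EuclideanSpace.inner_eq_star_dotProduct] at this
  rw [← this]
  simp [mul_apply, dotProduct, mul_comm, f, b]

/-- **Singular value decomposition** of a square complex matrix. -/
theorem exists_singular_value_decomposition {m : ℕ} (X : Matrix (Fin m) (Fin m) ℂ) :
    ∃ U ∈ unitaryGroup (Fin m) ℂ, ∃ V ∈ unitaryGroup (Fin m) ℂ, ∃ s : Fin m → ℝ,
      (∀ i, 0 ≤ s i) ∧ X = U * diagonal (fun i => (s i : ℂ)) * V := by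
  obtain ⟨V, hVm, e, h⟩ :=
    (isHermitian_conjTranspose_mul_self X).exists_eq_unitary_mul_diagonal_mul
  have hVV : V * Vᴴ = 1 := mem_unitaryGroup_iff.mp hVm
  have hVV' : Vᴴ * V = 1 := mem_unitaryGroup_iff'.mp hVm
  have hspec : (X * V)ᴴ * (X * V) = diagonal (fun i => (e i : ℂ)) := by
    rw [conjTranspose_mul, mul_assoc, ← mul_assoc Xᴴ, h]
    simp only [mul_assoc, hVV', mul_one]
    rw [← mul_assoc, hVV', one_mul]
  -- The columns of Y are orthogonal; their norms are the singular values.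
  set Y := X * V with hY
  let f : Fin m → EuclideanSpace ℂ (Fin m) := fun j => WithLp.toLp 2 fun i => Y i j
  have hinner : ∀ i j, inner ℂ (f i) (f j) = (Yᴴ * Y) i j := fun i j => by
    rw [EuclideanSpace.inner_eq_star_dotProduct]
    simp [mul_apply, dotProduct, mul_comm, f]
  have horth : Pairwise fun i j => inner ℂ (f i) (f j) = 0 := fun i j hij => by
    simp [hinner, hspec, diagonal_apply_ne _ hij]
  let b := InnerProductSpace.gramSchmidtOrthonormalBasis (𝕜 := ℂ) (by simp) f
  refine ⟨_, of_orthonormalBasis_mem_unitaryGroup b, Vᴴ, conjTranspose_mem_unitaryGroup hVm, fun i => ‖f i‖,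
    fun i => norm_nonneg _, ?_⟩
  have hYeq : Y = (of fun i j => b j i) * diagonal (fun i => ((‖f i‖ : ℝ) : ℂ)) := by
    ext i j
    rw [mul_diagonal, of_apply]
    -- At a zero column the basis vector is arbitrary, but it is multiplied by 0.
    by_cases hj : f j = 0
    · have : f j i = 0 := by simp [hj]
      simpa [hj, f] using this
    · have hb := InnerProductSpace.gramSchmidtOrthonormalBasis_apply_of_orthogonal
        (𝕜 := ℂ) (by simp) horth hj
      have hbi : b j i = (‖f j‖ : ℂ)⁻¹ * Y i j := by
        simpa [f] using congrArg (fun v : EuclideanSpace ℂ (Fin m) => v i) hb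
      have hn : (‖f j‖ : ℂ) ≠ 0 := by simpa using hj
      rw [hbi]
      field_simp
  rw [← hYeq, hY, mul_assoc, hVV, mul_one]

end Matrix

/-- A bound for all terms of a sum over a finite type is a bound for their average. -/
theorem Seminorm.le_of_sum_eq_card_smul {E ι : Type*} [AddCommGroup E] [Module ℂ E] [Fintype ι]
    [Nonempty ι] (N : Seminorm ℂ E) (x : ι → E) (y : E) (c : ℝ) (hx : ∀ i, N (x i) ≤ c)
    (hsum : ∑ i, x i = (Fintype.card ι : ℂ) • y) : N y ≤ c := by
  have hpos : (0 : ℝ) < Fintype.card ι := by exact_mod_cast Fintype.card_pos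
  have h1 : Fintype.card ι * N y ≤ Fintype.card ι * c := by
    calc (Fintype.card ι : ℝ) * N y = N (∑ i, x i) := by rw [hsum, map_smul_eq_mul]; simp
      _ ≤ ∑ i, N (x i) := Finset.le_sum_of_subadditive N (map_zero N).le (map_add_le_add N) _ _
      _ ≤ ∑ _i : ι, c := Finset.sum_le_sum fun i _ => hx i
      _ = Fintype.card ι * c := by simp
  exact le_of_mul_le_mul_left h1 hpos

namespace Matrix

variable {n : Type*} [Fintype n] [DecidableEq n]

theorem diagonal_mem_unitaryGroup {c : n → ℂ} (hc : ∀ i, c i * star (c i) = 1) :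
    diagonal c ∈ unitaryGroup n ℂ := by
  rw [mem_unitaryGroup_iff, star_eq_conjTranspose, diagonal_conjTranspose, diagonal_mul_diagonal,
    ← diagonal_one]
  congr 1
  ext i
  simpa using hc i

end Matrix

/-! ### Basic inequalities for unitarily invariant norms -/

namespace IsUnitarilyInvariantNorm

variable {d : ℕ} {N : Seminorm ℂ (Matrix (Fin d) (Fin d) ℂ)} (hN : IsUnitarilyInvariantNorm N)
include hN

theorem unitary_mul {U : Matrix (Fin d) (Fin d) ℂ} (hU : U ∈ unitaryGroup (Fin d) ℂ)
    (X : Matrix (Fin d) (Fin d) ℂ) : N (U * X) = N X := by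
  simpa using hN.unitary_mul_mul U hU 1 (one_mem _) X

theorem mul_unitary {V : Matrix (Fin d) (Fin d) ℂ} (hV : V ∈ unitaryGroup (Fin d) ℂ)
    (X : Matrix (Fin d) (Fin d) ℂ) : N (X * V) = N X := by
  simpa using hN.unitary_mul_mul 1 (one_mem _) V hV X

/-- Pinching to the diagonal is a contraction. -/
theorem diagonal_diag_le (X : Matrix (Fin d) (Fin d) ℂ) : N (diagonal fun i => X i i) ≤ N X := by
  -- Averaging D X D over sign matrices D kills the off-diagonal entries.
  let D : (Fin d → ℤˣ) → Matrix (Fin d) (Fin d) ℂ := fun ε => diagonal fun i => ((ε i : ℤ) : ℂ)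
  have hD : ∀ ε, D ε ∈ unitaryGroup (Fin d) ℂ := fun ε => diagonal_mem_unitaryGroup fun i => by
    rcases Int.units_eq_one_or (ε i) with h | h <;> simp [h]
  refine N.le_of_sum_eq_card_smul (fun ε : Fin d → ℤˣ => D ε * X * D ε) _ _
    (fun ε => (hN.unitary_mul_mul _ (hD ε) _ (hD ε) X).le) ?_
  ext i j
  have h : ∀ ε : Fin d → ℤˣ, (D ε * X * D ε) i j = ((ε i : ℤ) : ℂ) * ((ε j : ℤ) : ℂ) * X i j :=
    fun ε => by simp only [D, mul_diagonal, diagonal_mul]; ring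
  rw [Matrix.sum_apply, Finset.sum_congr rfl fun ε _ => h ε, ← Finset.sum_mul, sum_sign_mul_sign]
  by_cases hij : i = j
  · subst hij; simp
  · simp [hij]

/-- Multiplication by a real diagonal contraction decreases the norm. -/
theorem diagonal_mul_le {c : Fin d → ℝ} (hc : ∀ i, c i ^ 2 ≤ 1) (X : Matrix (Fin d) (Fin d) ℂ) :
    N (diagonal (fun i => (c i : ℂ)) * X) ≤ N X := by
  -- A real c with c² ≤ 1 is the mean of the unimodular numbers c ± i√(1 - c²).
  let D : ℤˣ → Matrix (Fin d) (Fin d) ℂ := fun ε =>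
    diagonal fun i => (c i : ℂ) + ((ε : ℤ) : ℂ) * (√(1 - c i ^ 2) : ℝ) * Complex.I
  have hs : ∀ i, √(1 - c i ^ 2) * √(1 - c i ^ 2) = 1 - c i ^ 2 := fun i =>
    Real.mul_self_sqrt (by linarith [hc i])
  have hD : ∀ ε, D ε ∈ unitaryGroup (Fin d) ℂ := fun ε => diagonal_mem_unitaryGroup fun i => by
    rcases Int.units_eq_one_or ε with h | h <;>
      · apply Complex.ext
        · simp [h]; nlinarith [hs i]
        · simp [h]; ring
  refine N.le_of_sum_eq_card_smul (fun ε : ℤˣ => D ε * X) _ _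
    (fun ε => (hN.unitary_mul (hD ε) X).le) ?_
  rw [← Finset.sum_mul, ← smul_mul_assoc]
  congr 1
  ext i j
  by_cases hij : i = j
  · subst hij
    simp [D, Matrix.sum_apply]
    ring
  · simp [D, Matrix.sum_apply, hij]

theorem diagonal_le_diagonal {s t : Fin d → ℝ} (hs : ∀ i, 0 ≤ s i) (hst : ∀ i, s i ≤ t i) :
    N (diagonal fun i => (s i : ℂ)) ≤ N (diagonal fun i => (t i : ℂ)) := by
  have h : (diagonal fun i => (s i : ℂ)) =
      diagonal (fun i => ((s i / t i : ℝ) : ℂ)) * diagonal fun i => (t i : ℂ) := by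
    rw [diagonal_mul_diagonal]
    congr 1
    ext i
    by_cases ht : t i = 0
    · have : s i = 0 := le_antisymm (ht ▸ hst i) (hs i)
      simp [this]
    · rw [← Complex.ofReal_mul, div_mul_cancel₀ _ ht]
  rw [h]
  refine hN.diagonal_mul_le (fun i => ?_) _
  have h0 : 0 ≤ s i / t i := div_nonneg (hs i) ((hs i).trans (hst i))
  have h1 : s i / t i ≤ 1 := div_le_one_of_le₀ (hst i) ((hs i).trans (hst i))
  nlinarith

/-- Positivity makes the diagonal of E real and entrywise at least s; pinching E then leaves a
comparison of diagonal matrices. -/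
theorem diagonal_le_of_le_diag {s : Fin d → ℝ} (hs : ∀ i, 0 ≤ s i)
    {E : Matrix (Fin d) (Fin d) ℂ} (hE : (E - diagonal fun i => (s i : ℂ)).PosSemidef) :
    N (diagonal fun i => (s i : ℂ)) ≤ N E := by
  have hd : ∀ i, 0 ≤ E i i - s i := fun i => by simpa using hE.diag_nonneg (i := i)
  have him : ∀ i, E i i = ((E i i).re : ℂ) := fun i => by
    have := (Complex.nonneg_iff.mp (hd i)).2
    apply Complex.ext
    · simp
    · simpa using this.symm
  have hre : ∀ i, s i ≤ (E i i).re := fun i => by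
    have := (Complex.nonneg_iff.mp (hd i)).1
    simpa using this
  refine le_trans ?_ (hN.diagonal_diag_le E)
  rw [show (fun i => E i i) = fun i => ((E i i).re : ℂ) from funext him]
  exact hN.diagonal_le_diagonal hs hre

/-- Unitarily invariant norms are monotone on positive semidefinite matrices. -/
theorem mono_of_posSemidef {D E : Matrix (Fin d) (Fin d) ℂ} (hD : D.PosSemidef)
    (hDE : (E - D).PosSemidef) : N D ≤ N E := by
  obtain ⟨U, hUm, e, h⟩ := hD.1.exists_eq_unitary_mul_diagonal_mul
  have hUs : Uᴴ ∈ unitaryGroup (Fin d) ℂ := conjTranspose_mem_unitaryGroup hUm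
  have hUU' : Uᴴ * U = 1 := mem_unitaryGroup_iff'.mp hUm
  have h2 : Uᴴ * D * U = diagonal (fun i => (e i : ℂ)) := by
    conv_lhs => rw [h]
    simp only [mul_assoc, hUU', mul_one]
    rw [← mul_assoc, hUU', one_mul]
  rw [← hN.unitary_mul_mul _ hUs _ hUm D, ← hN.unitary_mul_mul _ hUs _ hUm E, h2]
  refine hN.diagonal_le_of_le_diag (fun i => ?_) ?_
  · have h3 := (hD.conjTranspose_mul_mul_same U).diag_nonneg (i := i)
    rwa [h2, diagonal_apply_eq, Complex.zero_le_real] at h3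
  rw [← h2, ← sub_mul, ← mul_sub]
  exact hDE.conjTranspose_mul_mul_same U

/-- Left multiplication by a contraction decreases the norm. -/
theorem contraction_mul_le {W : Matrix (Fin d) (Fin d) ℂ} (hW : (1 - Wᴴ * W).PosSemidef)
    (X : Matrix (Fin d) (Fin d) ℂ) : N (W * X) ≤ N X := by
  obtain ⟨U, hU, V, hV, s, hs, h⟩ := exists_singular_value_decomposition W
  have hUU' : Uᴴ * U = 1 := mem_unitaryGroup_iff'.mp hU
  have hVV : V * Vᴴ = 1 := mem_unitaryGroup_iff.mp hV
  have h2 : V * (1 - Wᴴ * W) * Vᴴ = diagonal fun i => ((1 - s i ^ 2 : ℝ) : ℂ) := by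
    rw [mul_sub, sub_mul, mul_one, hVV, h]
    simp only [conjTranspose_mul, mul_assoc, hVV, mul_one, diagonal_conjTranspose]
    rw [← mul_assoc V, hVV, one_mul, ← mul_assoc Uᴴ, hUU', one_mul, diagonal_mul_diagonal,
      ← diagonal_one, diagonal_sub]
    congr 1
    ext i
    simp [sq]
  have h3 := hW.mul_mul_conjTranspose_same V
  rw [h2] at h3
  have h4 : ∀ i, s i ^ 2 ≤ 1 := fun i => by
    have := h3.diag_nonneg (i := i)
    rw [diagonal_apply_eq, Complex.zero_le_real] at this
    linarith
  rw [h, mul_assoc, mul_assoc, hN.unitary_mul hU]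
  exact (hN.diagonal_mul_le h4 _).trans (hN.unitary_mul hV X).le

/-- An arithmetic-geometric mean inequality for unitarily invariant norms. -/
theorem mul_le_half_add (P Q : Matrix (Fin d) (Fin d) ℂ) :
    N (P * Q) ≤ (N (P * Pᴴ) + N (Qᴴ * Q)) / 2 := by
  obtain ⟨U, hU, V, hV, s, hs, h⟩ := exists_singular_value_decomposition (P * Q)
  have hUs : Uᴴ ∈ unitaryGroup (Fin d) ℂ := conjTranspose_mem_unitaryGroup hU
  have hVs : Vᴴ ∈ unitaryGroup (Fin d) ℂ := conjTranspose_mem_unitaryGroup hV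
  have hUU' : Uᴴ * U = 1 := mem_unitaryGroup_iff'.mp hU
  have hVV : V * Vᴴ = 1 := mem_unitaryGroup_iff.mp hV
  set S : Matrix (Fin d) (Fin d) ℂ := diagonal fun i => (s i : ℂ) with hS
  have hSeq : (Uᴴ * P) * (Q * Vᴴ) = S := by
    rw [mul_assoc, ← mul_assoc P, h]
    simp only [mul_assoc, hVV, mul_one]
    rw [← mul_assoc, hUU', one_mul]
  have hSH : Sᴴ = S := by
    rw [hS, diagonal_conjTranspose]
    congr 1
    ext i
    simp
  set P' := Uᴴ * P with hP'
  set Q' := Q * Vᴴ with hQ'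
  have hSeq' : Q'ᴴ * P'ᴴ = S := by rw [← conjTranspose_mul, hSeq, hSH]
  have hle : N S ≤ N ((2⁻¹ : ℂ) • (P' * P'ᴴ + Q'ᴴ * Q')) := by
    refine hN.diagonal_le_of_le_diag hs ?_
    -- Since S is Hermitian, both cross terms of the square equal S.
    have h1 : (2⁻¹ : ℂ) • (P' * P'ᴴ + Q'ᴴ * Q') - S =
        (2⁻¹ : ℂ) • ((P' - Q'ᴴ) * (P' - Q'ᴴ)ᴴ) := by
      rw [conjTranspose_sub, conjTranspose_conjTranspose, sub_mul, mul_sub, mul_sub, hSeq, hSeq']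
      module
    rw [← hS, h1]
    exact (posSemidef_self_mul_conjTranspose _).smul (by positivity)
  have h1 : N (P * Q) = N S := by rw [h, hN.unitary_mul_mul U hU V hV]
  have h2 : N (P' * P'ᴴ) = N (P * Pᴴ) := by
    rw [← hN.unitary_mul_mul _ hUs U hU (P * Pᴴ), hP', conjTranspose_mul,
      conjTranspose_conjTranspose]
    simp only [mul_assoc]
  have h3 : N (Q'ᴴ * Q') = N (Qᴴ * Q) := by
    rw [← hN.unitary_mul_mul V hV _ hVs (Qᴴ * Q), hQ', conjTranspose_mul,
      conjTranspose_conjTranspose]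
    simp only [mul_assoc]
  rw [h1]
  calc N S ≤ _ := hle
    _ = 2⁻¹ * N (P' * P'ᴴ + Q'ᴴ * Q') := by rw [map_smul_eq_mul]; simp
    _ ≤ 2⁻¹ * (N (P' * P'ᴴ) + N (Q'ᴴ * Q')) := by gcongr; exact map_add_le_add N _ _
    _ = _ := by rw [h2, h3]; ring

/-- A Hermitian matrix has the least norm among the matrices similar to it. -/
theorem le_of_similar {M M' G : Matrix (Fin d) (Fin d) ℂ} (hM : M.IsHermitian)
    (hG : IsUnit G) (h : G * M = M' * G) : N M ≤ N M' := by
  obtain ⟨U, hUm, e, hMU⟩ := hM.exists_eq_unitary_mul_diagonal_mul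
  have hUs : Uᴴ ∈ unitaryGroup (Fin d) ℂ := conjTranspose_mem_unitaryGroup hUm
  have hUU : U * Uᴴ = 1 := mem_unitaryGroup_iff.mp hUm
  have hUU' : Uᴴ * U = 1 := mem_unitaryGroup_iff'.mp hUm
  set D : Matrix (Fin d) (Fin d) ℂ := diagonal (fun i => (e i : ℂ)) with hD
  -- In the basis Q, M' becomes L = R D R⁻¹, upper triangular with the eigenvalues of M on its
  -- diagonal; pinching L recovers D.
  obtain ⟨Q, hQ, hR⟩ := exists_unitary_conjTranspose_mul_upperTriangular (G * U)
  have hQs : Qᴴ ∈ unitaryGroup (Fin d) ℂ := conjTranspose_mem_unitaryGroup hQ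
  have hQQ : Q * Qᴴ = 1 := mem_unitaryGroup_iff.mp hQ
  set R := Qᴴ * (G * U) with hRdef
  have hGU : IsUnit (G * U) := hG.mul (IsUnit.of_mul_eq_one _ hUU)
  have hRu : IsUnit R := (IsUnit.of_mul_eq_one _ (mem_unitaryGroup_iff.mp hQs)).mul hGU
  have hRtri : R.BlockTriangular id := fun i j hij => hR i j hij
  have hdet : IsUnit R.det := (isUnit_iff_isUnit_det R).mp hRu
  have hdiag : ∀ i, R i i ≠ 0 := by
    rw [det_of_isUpperTriangular hRtri] at hdet
    exact fun i => Finset.prod_ne_zero_iff.mp hdet.ne_zero i (Finset.mem_univ i)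
  set L := Qᴴ * M' * Q with hL
  have hLR : L * R = R * D := by
    have e1 : L * R = Qᴴ * (M' * G) * U := by
      rw [hL, hRdef]
      calc Qᴴ * M' * Q * (Qᴴ * (G * U)) = Qᴴ * M' * (Q * Qᴴ) * (G * U) := by
            simp only [mul_assoc]
        _ = _ := by rw [hQQ]; simp only [mul_assoc, mul_one]
    rw [e1, ← h, hMU, hRdef]
    simp only [mul_assoc, hUU', mul_one]
  have hLtri : L.BlockTriangular id := by
    let _ := hRu.invertible
    have : L = R * D * R⁻¹ := by
      rw [← hLR, mul_assoc, mul_nonsing_inv _ hdet, mul_one]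
    rw [this]
    exact (hRtri.mul (blockTriangular_diagonal _)).mul
      (blockTriangular_inv_of_blockTriangular hRtri)
  have hLd : ∀ i, L i i = e i := fun i => by
    have h1 : (L * R) i i = L i i * R i i := by
      rw [mul_apply]
      refine Finset.sum_eq_single i (fun k _ hk => ?_) (by simp)
      rcases lt_or_gt_of_ne hk with hk | hk
      · rw [hLtri hk, zero_mul]
      · rw [hRtri hk, mul_zero]
    rw [hLR, hD, mul_diagonal, mul_comm] at h1
    exact (mul_right_cancel₀ (hdiag i) h1).symm
  calc N M = N D := by rw [hMU, hN.unitary_mul_mul U hUm _ hUs]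
    _ = N (diagonal fun i => L i i) := by rw [hD]; simp only [hLd]
    _ ≤ N L := hN.diagonal_diag_le L
    _ = N M' := by rw [hL, hN.unitary_mul_mul _ hQs Q hQ]

end IsUnitarilyInvariantNorm

/-! ### Contractions, square roots and perturbation -/

namespace Matrix

variable {n : Type*} [Fintype n] [DecidableEq n]

/-- A product of a block row contraction and a block column contraction is a contraction. -/
theorem posSemidef_one_sub_conjTranspose_mul_self_sum {ι : Type*} [Fintype ι]
    {P Q : ι → Matrix n n ℂ} (hP : ∑ k, P k * (P k)ᴴ = 1) (hQ : ∑ k, (Q k)ᴴ * Q k = 1) :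
    (1 - (∑ k, P k * Q k)ᴴ * ∑ k, P k * Q k).PosSemidef := by
  set W := ∑ k, P k * Q k with hW
  have hW' : ∑ k, (Q k)ᴴ * (P k)ᴴ = Wᴴ := by simp [hW, conjTranspose_sum]
  -- Completing the square: the quadratic terms sum to Wᴴ W, each cross sum is Wᴴ W, and the last
  -- terms sum to 1.
  have h : 1 - Wᴴ * W = ∑ k, ((P k)ᴴ * W - Q k)ᴴ * ((P k)ᴴ * W - Q k) := by
    have e : ∀ k, ((P k)ᴴ * W - Q k)ᴴ * ((P k)ᴴ * W - Q k) =
        Wᴴ * (P k * (P k)ᴴ) * W - Wᴴ * (P k * Q k) - (Q k)ᴴ * (P k)ᴴ * W + (Q k)ᴴ * Q k :=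
      fun k => by
        simp only [conjTranspose_sub, conjTranspose_mul, conjTranspose_conjTranspose]
        noncomm_ring
    simp only [e, Finset.sum_add_distrib, Finset.sum_sub_distrib, ← Finset.sum_mul,
      ← Finset.mul_sum, hP, hQ, hW', ← hW]
    noncomm_ring
  rw [h]
  exact posSemidef_sum _ fun k _ => posSemidef_conjTranspose_mul_self _

theorem PosDef.exists_isHermitian_mul_self {F : Matrix n n ℂ} (hF : F.PosDef) :
    ∃ S R : Matrix n n ℂ, S.IsHermitian ∧ R.IsHermitian ∧ S * S = F ∧ S * R = 1 ∧ R * S = 1 := by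
  have hS : CFC.sqrt F * CFC.sqrt F = F := CFC.sqrt_mul_sqrt_self F hF.posSemidef.nonneg
  have hSH : (CFC.sqrt F).IsHermitian := (nonneg_iff_posSemidef.mp (CFC.sqrt_nonneg F)).1
  have hu : IsUnit (CFC.sqrt F).det := by
    have h := (isUnit_iff_isUnit_det F).mp hF.isUnit
    rw [← hS, det_mul] at h
    exact isUnit_of_mul_isUnit_left h
  exact ⟨_, _, hSH, hSH.inv, hS, mul_nonsing_inv _ hu, nonsing_inv_mul _ hu⟩

end Matrix

/-- A perturbation argument: an inequality between two polynomial expressions that holds for all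
small positive parameters holds at zero. -/
theorem Seminorm.le_of_forall_pos_perturbation {E : Type*} [AddCommGroup E] [Module ℂ E]
    (N : Seminorm ℂ E) {X X₁ X₂ Y Y₁ Y₂ : E}
    (h : ∀ δ : ℝ, 0 < δ → N (X + ((δ : ℂ) • X₁ + (δ : ℂ) • (δ : ℂ) • X₂)) ≤
      N (Y + ((δ : ℂ) • Y₁ + (δ : ℂ) • (δ : ℂ) • Y₂))) : N X ≤ N Y := by
  have hN : ∀ (Z₁ Z₂ : E) (δ : ℝ), 0 < δ → δ ≤ 1 →
      N ((δ : ℂ) • Z₁ + (δ : ℂ) • (δ : ℂ) • Z₂) ≤ δ * (N Z₁ + N Z₂) := by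
    intro Z₁ Z₂ δ h0 h1
    refine (map_add_le_add N _ _).trans ?_
    simp only [map_smul_eq_mul, Complex.norm_real, Real.norm_of_nonneg h0.le]
    nlinarith [mul_nonneg h0.le (apply_nonneg N Z₂)]
  set C := N X₁ + N X₂ + (N Y₁ + N Y₂) with hC
  have hC0 : 0 ≤ C := by positivity
  refine le_of_forall_pos_le_add fun ε hε => ?_
  set δ := min 1 (ε / (C + 1)) with hδ
  have hδ0 : 0 < δ := lt_min one_pos (by positivity)
  have hδ1 : δ ≤ 1 := min_le_left _ _
  have hδC : δ * (C + 1) ≤ ε := (le_div_iff₀ (by positivity)).mp (min_le_right _ _)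
  have h1 := hN X₁ X₂ δ hδ0 hδ1
  have h2 := hN Y₁ Y₂ δ hδ0 hδ1
  have h3 := h δ hδ0
  have h4 := map_add_le_add N Y ((δ : ℂ) • Y₁ + (δ : ℂ) • (δ : ℂ) • Y₂)
  have h5 := map_sub_le_add N (X + ((δ : ℂ) • X₁ + (δ : ℂ) • (δ : ℂ) • X₂))
    ((δ : ℂ) • X₁ + (δ : ℂ) • (δ : ℂ) • X₂)
  rw [add_sub_cancel_right] at h5
  nlinarith

/-! ### The inequality for commuting squares -/

namespace IsUnitarilyInvariantNorm

variable {d : ℕ} {N : Seminorm ℂ (Matrix (Fin d) (Fin d) ℂ)} (hN : IsUnitarilyInvariantNorm N)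
include hN

/-- If a Hermitian matrix factors as `a * W * b` with a contraction `W` and invertible Hermitian
`a`, `b`, then the norm of its square is at most that of `a ^ 2 * b ^ 2`. -/
theorem mul_self_le_of_eq_mul_contraction_mul {T a a' b b' W : Matrix (Fin d) (Fin d) ℂ}
    (hT : T.IsHermitian) (ha : a.IsHermitian) (hb : b.IsHermitian) (haa' : a * a' = 1)
    (ha'a : a' * a = 1) (hbb' : b * b' = 1) (hb'b : b' * b = 1) (hTW : T = a * W * b)
    (hW : (1 - Wᴴ * W).PosSemidef) (hW' : (1 - W * Wᴴ).PosSemidef) :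
    N (T * T) ≤ N (a * a * (b * b)) := by
  -- Conjugation by a' moves the leading factor a of a W b a W b to the end.
  have h1 : N (T * T) ≤ N (W * (b * a * W * (b * a))) := by
    refine hN.le_of_similar (G := a') ?_ (IsUnit.of_mul_eq_one _ ha'a) ?_
    · rw [IsHermitian, conjTranspose_mul, hT.eq]
    · have e1 : a' * (T * T) = (a' * a) * W * b * a * W * b := by
        rw [hTW]; simp only [mul_assoc]
      have e2 : W * (b * a * W * (b * a)) * a' = W * b * a * W * b * (a * a') := by
        simp only [mul_assoc]
      rw [e1, e2, ha'a, haa', one_mul, mul_one]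
  have h2 := hN.contraction_mul_le hW (b * a * W * (b * a))
  have h3 := hN.mul_le_half_add (b * a * W) (b * a)
  have h4 : N (b * a * W * (b * a * W)ᴴ) ≤ N (b * a * (b * a)ᴴ) := by
    refine hN.mono_of_posSemidef (posSemidef_self_mul_conjTranspose _) ?_
    have := hW'.mul_mul_conjTranspose_same (b * a)
    rw [mul_sub, sub_mul, mul_one] at this
    simpa only [conjTranspose_mul, mul_assoc] using this
  have h5 : N (b * a * (b * a)ᴴ) ≤ N (a * a * (b * b)) := by
    refine hN.le_of_similar (G := b') (isHermitian_mul_conjTranspose_self _)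
      (IsUnit.of_mul_eq_one _ hb'b) ?_
    have e1 : b' * (b * a * (b * a)ᴴ) = (b' * b) * a * a * b := by
      rw [conjTranspose_mul, ha.eq, hb.eq]; simp only [mul_assoc]
    have e2 : a * a * (b * b) * b' = a * a * b * (b * b') := by simp only [mul_assoc]
    rw [e1, e2, hb'b, hbb', one_mul, mul_one]
  have h6 : N ((b * a)ᴴ * (b * a)) ≤ N (a * a * (b * b)) := by
    refine hN.le_of_similar (G := a) (isHermitian_conjTranspose_mul_self _)
      (IsUnit.of_mul_eq_one _ haa') ?_
    rw [conjTranspose_mul, ha.eq, hb.eq]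
    simp only [mul_assoc]
  linarith

/-- The norm inequality for commuting pairs of squares of Hermitian matrices. -/
theorem sum_mul_self_mul_mul_self_le {ι : Type*} [Fintype ι] [DecidableEq ι]
    {a b : ι → Matrix (Fin d) (Fin d) ℂ} (ha : ∀ k, (a k).IsHermitian)
    (hb : ∀ k, (b k).IsHermitian) (hab : ∀ k, Commute (a k) (b k))
    (hA : (∑ k, a k * a k).PosDef) (hB : (∑ k, b k * b k).PosDef) :
    N (∑ k, a k * a k * (b k * b k)) ≤ N ((∑ k, a k * a k) * ∑ k, b k * b k) := by
  obtain ⟨S, S', hS, hS', hSS, hSS', hS'S⟩ := hA.exists_isHermitian_mul_self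
  obtain ⟨R, R', hR, hR', hRR, hRR', hR'R⟩ := hB.exists_isHermitian_mul_self
  let σ : ℤˣ → ℂ := fun u => ((u : ℤ) : ℂ)
  have hσ : ∀ u, σ u * σ u = 1 := fun u => by
    rcases Int.units_eq_one_or u with h | h <;> simp [σ, h]
  have hσs : ∀ u, star (σ u) = σ u := fun u => by simp [σ]
  let T : (ι → ℤˣ) → Matrix (Fin d) (Fin d) ℂ := fun ε => ∑ k, σ (ε k) • (a k * b k)
  refine N.le_of_sum_eq_card_smul (fun ε : ι → ℤˣ => T ε * T ε) _ _ (fun ε => ?_) ?_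
  · have hT : (T ε).IsHermitian := by
      simp only [IsHermitian, T, conjTranspose_sum, conjTranspose_smul, hσs, conjTranspose_mul,
        (ha _).eq, (hb _).eq, (hab _).eq]
    -- Normalising by S⁻¹ and R⁻¹ makes P a block row with P Pᴴ = 1 and Q a block column with Qᴴ Q =
    -- 1; the signs square away.
    let P : ι → Matrix (Fin d) (Fin d) ℂ := fun k => σ (ε k) • (S' * a k)
    let Q : ι → Matrix (Fin d) (Fin d) ℂ := fun k => b k * R'
    have hP : ∑ k, P k * (P k)ᴴ = 1 := by
      have e : ∀ k, P k * (P k)ᴴ = S' * (a k * a k) * S' := fun k => by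
        simp only [P, conjTranspose_smul, conjTranspose_mul, hσs, (ha k).eq, hS'.eq,
          smul_mul_smul_comm, hσ, one_smul, mul_assoc]
      simp only [e]
      rw [← Finset.sum_mul, ← Finset.mul_sum, ← hSS, ← mul_assoc, hS'S, one_mul, hSS']
    have hQ : ∑ k, (Q k)ᴴ * Q k = 1 := by
      have e : ∀ k, (Q k)ᴴ * Q k = R' * (b k * b k) * R' := fun k => by
        simp only [Q, conjTranspose_mul, (hb k).eq, hR'.eq, mul_assoc]
      simp only [e]
      rw [← Finset.sum_mul, ← Finset.mul_sum, ← hRR, ← mul_assoc, hR'R, one_mul, hRR']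
    have hW := posSemidef_one_sub_conjTranspose_mul_self_sum hP hQ
    have hW' := posSemidef_one_sub_conjTranspose_mul_self_sum (P := fun k => (Q k)ᴴ)
      (Q := fun k => (P k)ᴴ) (by simpa using hQ) (by simpa using hP)
    simp only [← conjTranspose_mul, ← conjTranspose_sum, conjTranspose_conjTranspose] at hW'
    have hTW : T ε = S * (∑ k, P k * Q k) * R := by
      rw [Finset.mul_sum, Finset.sum_mul]
      refine Finset.sum_congr rfl fun k _ => ?_
      calc σ (ε k) • (a k * b k) = σ (ε k) • ((S * S') * a k * b k * (R' * R)) := by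
            rw [hSS', hR'R, one_mul, mul_one]
        _ = S * (P k * Q k) * R := by
            simp only [P, Q, smul_mul_assoc, mul_smul_comm, mul_assoc]
    rw [← hSS, ← hRR]
    exact hN.mul_self_le_of_eq_mul_contraction_mul hT hS hR hSS' hS'S hRR' hR'R hTW hW hW'
  · have e1 : ∀ ε, T ε * T ε =
        ∑ k, ∑ l, (σ (ε k) * σ (ε l)) • ((a k * b k) * (a l * b l)) := fun ε => by
      simp only [T, Finset.sum_mul_sum, smul_mul_smul_comm]
    have e2 : ∀ k, a k * b k * (a k * b k) = a k * a k * (b k * b k) := fun k =>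
      (hab k).symm.mul_mul_mul_comm (a k) (b k)
    simp only [e1]
    rw [Finset.sum_comm, Finset.smul_sum]
    refine Finset.sum_congr rfl fun k _ => ?_
    rw [Finset.sum_comm]
    simp only [← Finset.sum_smul, σ, sum_sign_mul_sign, ite_smul, zero_smul]
    simp [e2]

end IsUnitarilyInvariantNorm

/-! ### Functional calculus and passage to the limit -/

namespace Matrix

variable {n : Type*} [Fintype n] [DecidableEq n]

/-- The spectrum is finite, hence f and g may be discontinuous. -/
theorem continuousOn_spectrum_real (A : Matrix n n ℂ) (f : ℝ → ℝ) :
    ContinuousOn f (spectrum ℝ A) :=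
  A.finite_real_spectrum.continuousOn f

theorem PosSemidef.nonneg_of_mem_spectrum_real {A : Matrix n n ℂ} (hA : A.PosSemidef) {x : ℝ}
    (hx : x ∈ spectrum ℝ A) : 0 ≤ x :=
  spectrum_nonneg_of_nonneg hA.nonneg hx

theorem PosSemidef.cfc_sqrt_add_mul_self {A : Matrix n n ℂ} (hA : A.PosSemidef) {f : ℝ → ℝ}
    (hf : ∀ x, 0 ≤ x → 0 ≤ f x) {δ : ℝ} (hδ : 0 < δ) :
    cfc (fun x => √(f x + δ)) A * cfc (fun x => √(f x + δ)) A = cfc f A + (δ : ℂ) • 1 := by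
  have hs : IsSelfAdjoint A := hA.1
  rw [← cfc_mul _ _ A (A.continuousOn_spectrum_real _) (A.continuousOn_spectrum_real _),
    cfc_congr (g := fun x => f x + δ) fun x hx => Real.mul_self_sqrt
      (add_nonneg (hf x (hA.nonneg_of_mem_spectrum_real hx)) hδ.le),
    cfc_add_const δ f A (A.continuousOn_spectrum_real _)]
  congr 1
  ext i j
  simp [algebraMap_matrix_apply, one_apply]

theorem posDef_sum_add_smul_one {m ι : Type*} [DecidableEq m] [Fintype ι] [Nonempty ι]
    {F : ι → Matrix m m ℂ} (hF : ∀ k, (F k).PosSemidef) {δ : ℝ} (hδ : 0 < δ) :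
    (∑ k, (F k + (δ : ℂ) • 1)).PosDef := by
  rw [Finset.sum_add_distrib]
  refine PosDef.posSemidef_add (posSemidef_sum _ fun k _ => hF k) ?_
  rw [Finset.sum_const, ← Nat.cast_smul_eq_nsmul ℂ, smul_smul]
  refine PosDef.one.smul ?_
  have : (0 : ℝ) < Fintype.card ι * δ := mul_pos (by exact_mod_cast Fintype.card_pos) hδ
  rw [Finset.card_univ]
  exact_mod_cast this

theorem PosSemidef.rpow_eq_cfc {A : Matrix n n ℂ} (hA : A.PosSemidef) (p : ℝ) :
    A ^ p = cfc (fun x : ℝ => x ^ p) A :=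
  CFC.rpow_eq_cfc_real hA.nonneg

theorem PosSemidef.rpow_add_of_pos {A : Matrix n n ℂ} (hA : A.PosSemidef) {p q : ℝ} (hp : 0 < p)
    (hq : 0 < q) : A ^ (p + q) = cfc (fun x : ℝ => x ^ p) A * cfc (fun x : ℝ => x ^ q) A := by
  rw [hA.rpow_eq_cfc, ← cfc_mul _ _ A (A.continuousOn_spectrum_real _)
    (A.continuousOn_spectrum_real _)]
  exact cfc_congr fun x hx =>
    Real.rpow_add_of_nonneg (hA.nonneg_of_mem_spectrum_real hx) hp.le hq.le

end Matrix

/-- The norm inequality for sums of products of functions of positive semidefinite matrices. -/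
theorem IsUnitarilyInvariantNorm.sum_cfc_mul_cfc_le {d : ℕ}
    {N : Seminorm ℂ (Matrix (Fin d) (Fin d) ℂ)} (hN : IsUnitarilyInvariantNorm N) {ι : Type*}
    [Fintype ι] (A : ι → Matrix (Fin d) (Fin d) ℂ) (hA : ∀ k, (A k).PosSemidef)
    {f g : ℝ → ℝ} (hf : ∀ x, 0 ≤ x → 0 ≤ f x) (hg : ∀ x, 0 ≤ x → 0 ≤ g x) :
    N (∑ k, cfc f (A k) * cfc g (A k)) ≤ N ((∑ k, cfc f (A k)) * ∑ k, cfc g (A k)) := by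
  classical
  -- An empty sum stays zero under the δ-shift and need not become positive definite.
  rcases isEmpty_or_nonempty ι with hι | hι
  · simp
  have hpsd : ∀ h : ℝ → ℝ, (∀ x, 0 ≤ x → 0 ≤ h x) → ∀ k, (cfc h (A k)).PosSemidef :=
    fun h hh k => nonneg_iff_posSemidef.mp
      (cfc_nonneg fun x hx => hh x ((hA k).nonneg_of_mem_spectrum_real hx))
  set F := fun k => cfc f (A k)
  set G := fun k => cfc g (A k)
  set c : ℂ := (Fintype.card ι : ℂ)
  -- These are the δ and δ² coefficients of Σ (F_k + δ)(G_k + δ) and (Σ F_k + cδ)(Σ G_k + cδ).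
  refine N.le_of_forall_pos_perturbation (X₁ := ∑ k, (F k + G k)) (X₂ := c • 1)
    (Y₁ := c • (∑ k, F k + ∑ k, G k)) (Y₂ := (c * c) • 1) fun δ hδ => ?_
  have key := hN.sum_mul_self_mul_mul_self_le (a := fun k => cfc (fun x => √(f x + δ)) (A k))
    (b := fun k => cfc (fun x => √(g x + δ)) (A k)) (fun k => cfc_predicate _ _)
    (fun k => cfc_predicate _ _) (fun k => cfc_commute_cfc _ _ _)
    (by simp only [(hA _).cfc_sqrt_add_mul_self hf hδ]
        exact posDef_sum_add_smul_one (hpsd f hf) hδ)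
    (by simp only [(hA _).cfc_sqrt_add_mul_self hg hδ]
        exact posDef_sum_add_smul_one (hpsd g hg) hδ)
  simp only [(hA _).cfc_sqrt_add_mul_self hf hδ, (hA _).cfc_sqrt_add_mul_self hg hδ] at key
  have hc : ∑ _k : ι, (δ : ℂ) • (1 : Matrix (Fin d) (Fin d) ℂ) = (c * δ) • 1 := by
    rw [Finset.sum_const, ← Nat.cast_smul_eq_nsmul ℂ, smul_smul, Finset.card_univ]
  convert key using 2
  · simp only [add_mul, mul_add, Finset.sum_add_distrib, smul_mul_assoc, mul_smul_comm, one_mul,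
      mul_one, ← Finset.smul_sum, smul_add]
    rw [Finset.sum_const, ← Nat.cast_smul_eq_nsmul ℂ, Finset.card_univ]
    module
  · simp only [Finset.sum_add_distrib, hc, add_mul, mul_add, smul_mul_assoc, mul_smul_comm,
      one_mul, mul_one]
    module

theorem mainTheorem3 (d : ℕ) (N : Seminorm ℂ (Matrix (Fin d) (Fin d) ℂ))
    (hN : IsUnitarilyInvariantNorm N) :
    (∀ (K : ℕ) (A : Fin K → Matrix (Fin d) (Fin d) ℂ) (_ : ∀ k, (A k).PosSemidef)
        (f g : ℝ → ℝ) (_ : ∀ x, 0 ≤ x → 0 ≤ f x) (_ : ∀ x, 0 ≤ x → 0 ≤ g x),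
        N (∑ k, cfc f (A k) * cfc g (A k)) ≤ N ((∑ k, cfc f (A k)) * (∑ k, cfc g (A k)))) ∧
    (∀ (A B : Matrix (Fin d) (Fin d) ℂ) (_ : A.PosSemidef) (_ : B.PosSemidef)
        (p q : ℝ) (_ : 0 < p) (_ : 0 < q),
        N (A ^ (p + q) + B ^ (p + q)) ≤ N ((A ^ p + B ^ p) * (A ^ q + B ^ q))) := by
  refine ⟨fun K A hA f g hf hg => hN.sum_cfc_mul_cfc_le A hA hf hg, ?_⟩
  intro A B hA hB p q hp hq
  have h := hN.sum_cfc_mul_cfc_le ![A, B] (by simp [Fin.forall_fin_two, hA, hB])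
    (f := fun x => x ^ p) (g := fun x => x ^ q) (fun x hx => Real.rpow_nonneg hx p)
    (fun x hx => Real.rpow_nonneg hx q)
  simp only [Fin.sum_univ_two, cons_val_zero, cons_val_one] at h
  rwa [hA.rpow_add_of_pos hp hq, hB.rpow_add_of_pos hp hq, hA.rpow_eq_cfc, hA.rpow_eq_cfc,
    hB.rpow_eq_cfc, hB.rpow_eq_cfc]
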